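/- Let $\mathfrak g$ be a finite-dimensional real semisimple Lie algebra (for instance a semisimple subalgebra of $\mathfrak{gl}(n,\mathbb R)$), let $\mathfrak c$ be a Cartan subalgebra of $\mathfrak g$, and write $\mathfrak g^{\mathbb C}=\mathfrak g\otimes_{\mathbb R}\mathbb C$ and $\mathfrak c^{\mathbb C}=\mathfrak c\otimes_{\mathbb R}\mathbb C$ for the complexifications. Fix a positive system $R^+$ of roots of $\mathfrak c^{\mathbb C}$ in $\mathfrak g^{\mathbb C}$, that is, a set of roots which contains exactly one of $\alpha,-\alpha$ for every root $\alpha$, and which contains $\alpha+\beta$ whenever $\alpha,\beta\in R^+$ and $\alpha+\beta$ is a root. Let $\mathfrak y=\sum_{\alpha\in R^+}(\mathfrak g^{\mathbb C})_\alpha$ be the sum of the corresponding root spaces, i.e. the nil-radical of the Borel subalgebra $\mathfrak c^{\mathbb C}+\mathfrak y$. Let $V$ be a finite-dimensional real representation of $\mathfrak g$, let $V^{\mathbb C}=V\otimes_{\mathbb R}\mathbb C=V\oplus\sqrt{-1}\,V$ be its complexification, a representation of $\mathfrak g^{\mathbb C}$, and let $\sigma(v+\sqrt{-1}\,w)=v-\sqrt{-1}\,w$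 be the conjugation of $V^{\mathbb C}$. For a complex subspace $M\subseteq V^{\mathbb C}$ write $\overline M=\sigma(M)$. A linear function $\lambda:\mathfrak c^{\mathbb C}\to\mathbb C$ is a high weight of a $\mathfrak g^{\mathbb C}$-invariant subspace $M$ of $V^{\mathbb C}$ relative to $(\mathfrak y,\mathfrak c^{\mathbb C})$ if there is a nonzero $v\in M$ with $n\cdot v=0$ for all $n\in\mathfrak y$ and $h\cdot v=\lambda(h)v$ for all $h\in\mathfrak c^{\mathbb C}$. Let $M$ be a $\mathfrak g^{\mathbb C}$-invariant subspace of $V^{\mathbb C}$ such that $M$ and $\overline M$ are irreducible, with high weights $\lambda$ and $\mu$, respectively, relative to $(\mathfrak y,\mathfrak c^{\mathbb C})$. If $\lambda\neq\mu$, then $M\cap\overline M=0$, so that the sum $M+\overline M$ is direct, and the real points $(M+\overline M)\cap V$ form an irreducible $\mathfrak g$-invariant subspace of $V$. -/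

import Mathlib

open scoped TensorProduct

noncomputable section

namespace RealRep

/-- Complex conjugation `σ` on the complexification `V^ℂ = ℂ ⊗[ℝ] V` of a real vector space `V`,
`z ⊗ v ↦ z̄ ⊗ v`, i.e. `v + √-1 w ↦ v - √-1 w`. -/
def conj (V : Type*) [AddCommGroup V] [Module ℝ V] : ℂ ⊗[ℝ] V →ₗ[ℝ] ℂ ⊗[ℝ] V :=
  LinearMap.rTensor V Complex.conjAe.toLinearMap

section VectorSpace

variable {V : Type*} [AddCommGroup V] [Module ℝ V]

@[simp]
theorem conj_tmul (z : ℂ) (v : V) :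
    conj V (z ⊗ₜ[ℝ] v) = (starRingEnd ℂ z) ⊗ₜ[ℝ] v := by
  simp [conj]

theorem conj_smul (z : ℂ) (x : ℂ ⊗[ℝ] V) : conj V (z • x) = (starRingEnd ℂ z) • conj V x := by
  induction x using TensorProduct.induction_on with
  | zero => simp
  | tmul w v => simp [TensorProduct.smul_tmul']
  | add x y hx hy => simp only [smul_add, map_add, hx, hy]

theorem conj_conj (x : ℂ ⊗[ℝ] V) : conj V (conj V x) = x := by
  induction x using TensorProduct.induction_on with
  | zero => simp
  | tmul w v => simp
  | add x y hx hy => simp only [map_add, hx, hy]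

end VectorSpace

section Representation

variable {g V : Type*} [LieRing g] [LieAlgebra ℝ g]
  [AddCommGroup V] [Module ℝ V] [LieRingModule g V] [LieModule ℝ g V]

theorem conj_lie (x : ℂ ⊗[ℝ] g) (m : ℂ ⊗[ℝ] V) :
    conj V ⁅x, m⁆ = ⁅conj g x, conj V m⁆ := by
  induction x using TensorProduct.induction_on with
  | zero => simp
  | add x y hx hy => simp only [add_lie, map_add, hx, hy]
  | tmul z a =>
    induction m using TensorProduct.induction_on with
    | zero => rw [lie_zero (z ⊗ₜ[ℝ] a), map_zero, lie_zero (conj g (z ⊗ₜ[ℝ] a))]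
    | add x y hx hy => rw [lie_add (z ⊗ₜ[ℝ] a) x y, map_add, map_add,
        lie_add (conj g (z ⊗ₜ[ℝ] a)) (conj V x) (conj V y), hx, hy]
    | tmul w v => simp [LieAlgebra.ExtendScalars.bracket_tmul]

/-- The conjugate `M̄ = σ(M)` of a `g^ℂ`-invariant complex subspace `M` of `V^ℂ`. -/
def conjSubmodule (M : LieSubmodule ℂ (ℂ ⊗[ℝ] g) (ℂ ⊗[ℝ] V)) :
    LieSubmodule ℂ (ℂ ⊗[ℝ] g) (ℂ ⊗[ℝ] V) where
  carrier := conj V '' (M : Set (ℂ ⊗[ℝ] V))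
  zero_mem' := ⟨0, M.zero_mem, by simp⟩
  add_mem' := by
    rintro _ _ ⟨x, hx, rfl⟩ ⟨y, hy, rfl⟩
    exact ⟨x + y, M.add_mem hx hy, by simp⟩
  smul_mem' := by
    rintro z _ ⟨x, hx, rfl⟩
    exact ⟨(starRingEnd ℂ z) • x, M.smul_mem _ hx, by simp [conj_smul]⟩
  lie_mem := by
    rintro x _ ⟨m, hm, rfl⟩
    exact ⟨⁅conj g x, m⁆, M.lie_mem hm, by simp [conj_lie, conj_conj]⟩

/-- The real points `N ∩ V` of a `g^ℂ`-invariant subspace `N` of `V^ℂ`, where `V` is embedded in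
`V^ℂ` by `v ↦ 1 ⊗ v`; they form a `g`-invariant subspace of `V`. -/
def realPoints (N : LieSubmodule ℂ (ℂ ⊗[ℝ] g) (ℂ ⊗[ℝ] V)) : LieSubmodule ℝ g V where
  carrier := {v | (1 : ℂ) ⊗ₜ[ℝ] v ∈ N}
  zero_mem' := by simp
  add_mem' := by
    intro v w hv hw
    have h := N.add_mem hv hw
    rw [← TensorProduct.tmul_add] at h
    exact h
  smul_mem' := by
    intro r v hv
    have h := N.smul_mem (r : ℂ) hv
    have e : (r : ℂ) • ((1 : ℂ) ⊗ₜ[ℝ] v) = (1 : ℂ) ⊗ₜ[ℝ] (r • v) := by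
      simp [TensorProduct.smul_tmul']
    rw [e] at h
    exact h
  lie_mem := by
    intro x v hv
    have h := N.lie_mem (x := (1 : ℂ) ⊗ₜ[ℝ] x) hv
    rw [LieAlgebra.ExtendScalars.bracket_tmul, one_mul] at h
    exact h

end Representation

section Weights

variable {g : Type*} [LieRing g] [LieAlgebra ℝ g]

/-- The complexification `c^ℂ ⊆ g^ℂ` of a subalgebra `c` of `g`. -/
def cplx (c : LieSubalgebra ℝ g) : LieSubalgebra ℂ (ℂ ⊗[ℝ] g) where
  toSubmodule := c.toSubmodule.baseChange ℂ
  lie_mem' := by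
    intro x y hx hy
    simp only [Submodule.carrier_eq_coe, SetLike.mem_coe] at hx hy ⊢
    rw [Submodule.baseChange_eq_span] at hx hy
    induction hx using Submodule.span_induction with
    | zero => rw [zero_lie]; exact Submodule.zero_mem _
    | add a b _ _ ha hb => rw [add_lie]; exact Submodule.add_mem _ ha hb
    | smul t a _ ha => rw [smul_lie]; exact Submodule.smul_mem _ _ ha
    | mem a ha =>
      induction hy using Submodule.span_induction with
      | zero => rw [lie_zero]; exact Submodule.zero_mem _
      | add u v _ _ hu hv => rw [lie_add]; exact Submodule.add_mem _ hu hv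
      | smul t u _ hu => rw [lie_smul]; exact Submodule.smul_mem _ _ hu
      | mem u hu =>
        obtain ⟨p, hp, rfl⟩ := ha
        obtain ⟨q, hq, rfl⟩ := hu
        simp only [TensorProduct.mk_apply, LieAlgebra.ExtendScalars.bracket_tmul]
        exact Submodule.tmul_mem_baseChange_of_mem _ (c.lie_mem hp hq)

/-- `[h, x] = α(h) x` for all `h ∈ c^ℂ`. -/
def IsRootVector (c : LieSubalgebra ℝ g) (α : Module.Dual ℂ (cplx c)) (x : ℂ ⊗[ℝ] g) : Prop :=
  ∀ h : cplx c, ⁅(h : ℂ ⊗[ℝ] g), x⁆ = α h • x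

/-- The roots of `c^ℂ` in `g^ℂ`. -/
def IsRoot (c : LieSubalgebra ℝ g) (α : Module.Dual ℂ (cplx c)) : Prop :=
  α ≠ 0 ∧ ∃ x : ℂ ⊗[ℝ] g, x ≠ 0 ∧ IsRootVector c α x

/-- A positive system of roots of `c^ℂ`: a set of roots which contains exactly one of each pair
of opposite roots and contains every root that is a sum of two of its members. -/
structure IsPositiveSystem (c : LieSubalgebra ℝ g) (P : Set (Module.Dual ℂ (cplx c))) : Prop where
  isRoot : ∀ α ∈ P, IsRoot c α
  xor_neg : ∀ α, IsRoot c α → Xor (α ∈ P) (-α ∈ P)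
  add_mem : ∀ α ∈ P, ∀ β ∈ P, IsRoot c (α + β) → α + β ∈ P

/-- The sum `𝔶` of the root spaces of the positive roots: the nil-radical of the Borel subalgebra
`c^ℂ + 𝔶` determined by the positive system `P`. -/
def nilRadical (c : LieSubalgebra ℝ g) (P : Set (Module.Dual ℂ (cplx c))) :
    Submodule ℂ (ℂ ⊗[ℝ] g) :=
  Submodule.span ℂ {x | ∃ α ∈ P, IsRootVector c α x}

variable {V : Type*} [AddCommGroup V] [Module ℝ V] [LieRingModule g V] [LieModule ℝ g V]

/-- `v` is a high weight vector of weight `lam` relative to the pair `(𝔶, c^ℂ)`. -/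
def IsHighWeightVector (c : LieSubalgebra ℝ g) (𝔶 : Submodule ℂ (ℂ ⊗[ℝ] g))
    (lam : Module.Dual ℂ (cplx c)) (v : ℂ ⊗[ℝ] V) : Prop :=
  v ≠ 0 ∧ (∀ n ∈ 𝔶, ⁅n, v⁆ = 0) ∧ ∀ h : cplx c, ⁅(h : ℂ ⊗[ℝ] g), v⁆ = lam h • v

/-- `lam` is a high weight of the invariant subspace `M` of `V^ℂ` relative to `(𝔶, c^ℂ)`. -/
def IsHighWeight (c : LieSubalgebra ℝ g) (𝔶 : Submodule ℂ (ℂ ⊗[ℝ] g))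
    (M : LieSubmodule ℂ (ℂ ⊗[ℝ] g) (ℂ ⊗[ℝ] V)) (lam : Module.Dual ℂ (cplx c)) : Prop :=
  ∃ v ∈ M, IsHighWeightVector c 𝔶 lam v

end Weights

end RealRep

end

/-! An irreducible module has only one high weight: lowering operators generate it from a high
weight vector, so its weights are `lam` minus sums of positive roots, and such a sum vanishes only
if it is empty. If `M` met its conjugate `M̄` nontrivially, irreducibility would give `M = M̄`,
hence `lam = mu`.

For the real points, complexify a nonzero invariant subspace to a `conj`-stable submodule `W` of `M
+ M̄`. If `W` omits `M`, it also omits `M̄` by conjugation and so meets both trivially; it is then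
the graph of an isomorphism from `M` to `M̄`. This carries a high weight vector of `M` to one of
`M̄`, so again `lam = mu`. Thus `W` is all of `M + M̄`.

The carrying lemmas are `IsPositiveSystem.eq_nil_of_sum_eq_zero`, `IsHighWeight.unique`,
`IsHighWeight.of_le_sup` and `le_sup_conjSubmodule_of_not_le`. -/

noncomputable section

namespace RealRep

/-! ### Real and imaginary parts in a complexification. -/

section RealStructure

variable {V : Type*} [AddCommGroup V] [Module ℝ V]

/-- The real part `v + √-1 w ↦ v`. -/
def rePart (V : Type*) [AddCommGroup V] [Module ℝ V] : ℂ ⊗[ℝ] V →ₗ[ℝ] V :=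
  (TensorProduct.lid ℝ V).toLinearMap ∘ₗ LinearMap.rTensor V Complex.reLm

/-- The imaginary part `v + √-1 w ↦ w`. -/
def imPart (V : Type*) [AddCommGroup V] [Module ℝ V] : ℂ ⊗[ℝ] V →ₗ[ℝ] V :=
  (TensorProduct.lid ℝ V).toLinearMap ∘ₗ LinearMap.rTensor V Complex.imLm

@[simp]
theorem rePart_tmul (z : ℂ) (v : V) : rePart V (z ⊗ₜ[ℝ] v) = z.re • v := by
  simp [rePart]

@[simp]
theorem imPart_tmul (z : ℂ) (v : V) : imPart V (z ⊗ₜ[ℝ] v) = z.im • v := by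
  simp [imPart]

theorem rePart_add_imPart (x : ℂ ⊗[ℝ] V) :
    (1 : ℂ) ⊗ₜ[ℝ] rePart V x + Complex.I • ((1 : ℂ) ⊗ₜ[ℝ] imPart V x) = x := by
  induction x using TensorProduct.induction_on with
  | zero => simp
  | tmul z v =>
    rw [rePart_tmul, imPart_tmul, TensorProduct.smul_tmul', ← TensorProduct.smul_tmul,
      ← TensorProduct.smul_tmul, ← TensorProduct.add_tmul]
    congr 1
    apply Complex.ext <;> simp
  | add x y hx hy =>
    conv_rhs => rw [← hx, ← hy]
    simp only [map_add, TensorProduct.tmul_add, smul_add]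
    abel

theorem add_conj (x : ℂ ⊗[ℝ] V) : x + conj V x = (1 : ℂ) ⊗ₜ[ℝ] ((2 : ℝ) • rePart V x) := by
  have h : conj V x =
      (1 : ℂ) ⊗ₜ[ℝ] rePart V x - Complex.I • ((1 : ℂ) ⊗ₜ[ℝ] imPart V x) := by
    conv_lhs => rw [← rePart_add_imPart x]
    rw [map_add, conj_smul]
    simp [sub_eq_add_neg]
  rw [h]
  nth_rewrite 1 [← rePart_add_imPart x]
  rw [two_smul, TensorProduct.tmul_add]
  abel

theorem one_tmul_eq_zero_iff (v : V) : (1 : ℂ) ⊗ₜ[ℝ] v = 0 ↔ v = 0 :=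
  ⟨fun h ↦ by simpa using congrArg (rePart V) h, fun h ↦ by simp [h]⟩

theorem rePart_mem_and_imPart_mem {p : Submodule ℝ V} {x : ℂ ⊗[ℝ] V}
    (hx : x ∈ p.baseChange ℂ) : rePart V x ∈ p ∧ imPart V x ∈ p := by
  rw [Submodule.baseChange_eq_span] at hx
  induction hx using Submodule.span_induction with
  | zero => simp
  | add a b _ _ ha hb => simpa using ⟨add_mem ha.1 hb.1, add_mem ha.2 hb.2⟩
  | mem a ha => obtain ⟨v, hv, rfl⟩ := ha; simpa using hv
  | smul z a _ ha =>
    rw [← rePart_add_imPart a]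
    simp only [smul_add, TensorProduct.smul_tmul', smul_eq_mul, map_add, rePart_tmul, imPart_tmul]
    exact ⟨add_mem (p.smul_mem _ ha.1) (p.smul_mem _ ha.2),
      add_mem (p.smul_mem _ ha.1) (p.smul_mem _ ha.2)⟩

theorem mem_baseChange_iff_rePart_imPart {p : Submodule ℝ V} {x : ℂ ⊗[ℝ] V} :
    x ∈ p.baseChange ℂ ↔ rePart V x ∈ p ∧ imPart V x ∈ p := by
  refine ⟨rePart_mem_and_imPart_mem, fun h ↦ ?_⟩
  rw [← rePart_add_imPart x]
  exact add_mem (Submodule.tmul_mem_baseChange_of_mem _ h.1)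
    (Submodule.smul_mem _ _ (Submodule.tmul_mem_baseChange_of_mem _ h.2))

end RealStructure

/-! ### Semisimplicity and Cartan subalgebras under complexification. -/

section Complexification

variable {g : Type*} [LieRing g] [LieAlgebra ℝ g]

/-- The Killing form commutes with base change. Pairing `x` with a real vector has the pairings of
its real and imaginary parts as real and imaginary parts, so both lie in the radical of the real
Killing form. -/
theorem isKilling_complexification [FiniteDimensional ℝ g] [LieAlgebra.IsKilling ℝ g] :
    LieAlgebra.IsKilling ℂ (ℂ ⊗[ℝ] g) where
  killingCompl_top_eq_bot := by
    rw [eq_bot_iff]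
    intro x hx
    rw [LieIdeal.mem_killingCompl] at hx
    have key : ∀ y : g, killingForm ℝ g y (rePart g x) = 0 ∧
        killingForm ℝ g y (imPart g x) = 0 := by
      intro y
      have h := hx ((1 : ℂ) ⊗ₜ[ℝ] y) (LieSubmodule.mem_top _)
      rw [show killingForm ℂ (ℂ ⊗[ℝ] g) = (killingForm ℝ g).baseChange ℂ from
        LieModule.traceForm_baseChange ℝ g g ℂ, ← rePart_add_imPart x, map_add, map_smul] at h
      simp only [LinearMap.BilinForm.baseChange_tmul, mul_one, smul_eq_mul,
        Complex.real_smul] at h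
      exact ⟨by simpa using congrArg Complex.re h, by simpa using congrArg Complex.im h⟩
    have zero : ∀ a : g, (∀ y, killingForm ℝ g y a = 0) → a = 0 := by
      intro a ha
      have : a ∈ LieIdeal.killingCompl ℝ g ⊤ := (LieIdeal.mem_killingCompl ..).2 fun y _ ↦ ha y
      simpa using this
    rw [LieSubmodule.mem_bot, ← rePart_add_imPart x, zero _ fun y ↦ (key y).1,
      zero _ fun y ↦ (key y).2]
    simp

/-- The complexified inclusion of a subalgebra. -/
def cplxIncl (c : LieSubalgebra ℝ g) : ℂ ⊗[ℝ] c →ₗ⁅ℂ⁆ ℂ ⊗[ℝ] g :=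
  { c.toSubmodule.subtype.baseChange ℂ with
    map_lie' := by
      intro x y
      exact (LieAlgebra.ExtendScalars.map (AlgHom.id ℝ ℂ) c.incl).map_lie x y }

theorem range_cplxIncl (c : LieSubalgebra ℝ g) : (cplxIncl c).range = cplx c := by
  apply LieSubalgebra.toSubmodule_injective
  change LinearMap.range (c.toSubmodule.subtype.baseChange ℂ) = c.toSubmodule.baseChange ℂ
  rfl

/-- Nilpotency passes to the image of `ℂ ⊗ c`. Bracketing with real elements of `c` respects real
and imaginary parts, so both parts of a normalizing element normalize `c`. -/
theorem isCartanSubalgebra_cplx (c : LieSubalgebra ℝ g) [c.IsCartanSubalgebra] :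
    (cplx c).IsCartanSubalgebra where
  nilpotent := by
    rw [← range_cplxIncl c]
    exact (cplxIncl c).surjective_rangeRestrict.lieAlgebra_isNilpotent
  self_normalizing := by
    refine le_antisymm (fun x hx ↦ ?_) (LieSubalgebra.le_normalizer _)
    rw [LieSubalgebra.mem_normalizer_iff] at hx
    have key : ∀ y ∈ c, ⁅rePart g x, y⁆ ∈ c ∧ ⁅imPart g x, y⁆ ∈ c := by
      intro y hy
      have h : ⁅x, (1 : ℂ) ⊗ₜ[ℝ] y⁆ ∈ c.toSubmodule.baseChange ℂ :=
        hx _ (Submodule.tmul_mem_baseChange_of_mem _ hy)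
      rw [← rePart_add_imPart x, add_lie, TensorProduct.smul_tmul'] at h
      simp only [LieAlgebra.ExtendScalars.bracket_tmul] at h
      simpa using rePart_mem_and_imPart_mem h
    have mem : ∀ a : g, (∀ y ∈ c, ⁅a, y⁆ ∈ c) → a ∈ c := fun a ha ↦ by
      rwa [← LieSubalgebra.mem_normalizer_iff,
        LieSubalgebra.IsCartanSubalgebra.self_normalizing] at ha
    exact mem_baseChange_iff_rePart_imPart.2
      ⟨mem _ fun y hy ↦ (key y hy).1, mem _ fun y hy ↦ (key y hy).2⟩

end Complexification

theorem _root_.LieSubmodule.exists_mem_ne_zero {K L M : Type*} [CommRing K] [LieRing L]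
    [AddCommGroup M] [Module K M] [LieRingModule L M] {N : LieSubmodule K L M} (h : N ≠ ⊥) :
    ∃ x ∈ N, x ≠ 0 :=
  Submodule.exists_mem_ne_zero_of_ne_bot (by simpa using h : N.toSubmodule ≠ ⊥)

/-! ### Roots and positive systems. -/

section PositiveSystem

open LieAlgebra LieAlgebra.IsKilling LieModule

variable {g : Type*} [LieRing g] [LieAlgebra ℝ g] {c : LieSubalgebra ℝ g}

theorem IsRootVector.mem_weightSpace {α : Module.Dual ℂ (cplx c)} {x : ℂ ⊗[ℝ] g}
    (hx : IsRootVector c α x) : x ∈ weightSpace (ℂ ⊗[ℝ] g) (α : cplx c → ℂ) :=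
  (LieModule.mem_weightSpace (α : cplx c → ℂ) x).2 hx

variable [FiniteDimensional ℝ g] [IsKilling ℂ (ℂ ⊗[ℝ] g)] [(cplx c).IsCartanSubalgebra]

/-- `rootSpace` consists of generalized eigenvectors; they are genuine ones because a Cartan
subalgebra of a Killing Lie algebra acts semisimply. -/
theorem isRoot_iff {α : Module.Dual ℂ (cplx c)} :
    IsRoot c α ↔ α ≠ 0 ∧ rootSpace (cplx c) (α : cplx c → ℂ) ≠ ⊥ := by
  refine and_congr_right fun _ ↦ ⟨?_, fun h ↦ ?_⟩
  · rintro ⟨x, hx0, hx⟩ h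
    have : x ∈ rootSpace (cplx c) (α : cplx c → ℂ) :=
      weightSpace_le_genWeightSpace _ _ hx.mem_weightSpace
    exact hx0 (by simpa [h] using this)
  · obtain ⟨x, hx, hx0⟩ := LieSubmodule.exists_mem_ne_zero h
    exact ⟨x, hx0, fun h ↦ lie_eq_smul_of_mem_rootSpace hx h⟩

theorem IsRoot.exists_weight {α : Module.Dual ℂ (cplx c)} (hα : IsRoot c α) :
    ∃ χ : Weight ℂ (cplx c) (ℂ ⊗[ℝ] g), χ.IsNonZero ∧ (χ : cplx c → ℂ) = α := by
  obtain ⟨h0, h⟩ := isRoot_iff.1 hα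
  refine ⟨⟨α, h⟩, fun h' ↦ h0 ?_, rfl⟩
  ext x
  exact congrFun (f := (α : cplx c → ℂ)) h' x

theorem _root_.LieModule.Weight.IsNonZero.isRoot {χ : Weight ℂ (cplx c) (ℂ ⊗[ℝ] g)}
    (hχ : χ.IsNonZero) : IsRoot c χ.toLinear :=
  isRoot_iff.2 ⟨by simpa using hχ, χ.genWeightSpace_ne_bot⟩

/-- The sum of a nonempty list of positive roots is nonzero. -/
theorem IsPositiveSystem.eq_nil_of_sum_eq_zero {P : Set (Module.Dual ℂ (cplx c))}
    (hP : IsPositiveSystem c P) (l : List (Module.Dual ℂ (cplx c))) (hl : ∀ α ∈ l, α ∈ P)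
    (hsum : l.sum = 0) : l = [] := by
  induction hn : l.length generalizing l with
  | zero => exact List.length_eq_zero_iff.1 hn
  | succ n ih =>
  obtain _ | ⟨α, t⟩ := l
  · rfl
  exfalso
  have hαP : α ∈ P := hl α (by simp)
  obtain ⟨χ, hχ, hχα⟩ := (hP.isRoot α hαP).exists_weight
  have hα2 : α (coroot χ) = 2 := by rw [← hχα]; exact root_apply_coroot hχ
  have hint : ∀ β ∈ t, ∃ ψ : Weight ℂ (cplx c) (ℂ ⊗[ℝ] g), (ψ : cplx c → ℂ) = β := fun β hβ ↦
    (hP.isRoot β (hl β (by simp [hβ]))).exists_weight.imp fun _ h ↦ h.2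
  -- Evaluate the zero sum on the coroot of `α`: `α` contributes 2, while a `β` whose `α`-string
  -- stops at `β` contributes `chainBotCoeff`, which is nonnegative. Hence some string continues
  -- upward, and `α + β` is a weight.
  have hneg : ∃ β ∈ t, ∃ ψ : Weight ℂ (cplx c) (ℂ ⊗[ℝ] g), (ψ : cplx c → ℂ) = β ∧
      0 < chainTopCoeff χ ψ := by
    by_contra! H
    have hre : ∀ s : List (Module.Dual ℂ (cplx c)), (∀ β ∈ s, β ∈ t) →
        0 ≤ (s.sum (coroot χ)).re := by
      intro s hs
      induction s with
      | nil => simp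
      | cons β s ihs =>
        obtain ⟨ψ, hψ⟩ := hint β (hs β (by simp))
        have h0 : chainTopCoeff χ ψ = 0 := by simpa using H β (hs β (by simp)) ψ hψ
        have h1 : β (coroot χ) = (chainBotCoeff χ ψ : ℂ) := by
          rw [← hψ, apply_coroot_eq_cast, h0]; simp
        have h2 := ihs fun γ hγ ↦ hs γ (by simp [hγ])
        simp only [List.sum_cons, LinearMap.add_apply, Complex.add_re, h1, Complex.natCast_re]
        positivity
    have h3 := hre t fun _ h ↦ h
    have h4 := congrArg (fun f : Module.Dual ℂ (cplx c) ↦ (f (coroot χ)).re) hsum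
    simp only [List.sum_cons, LinearMap.add_apply, Complex.add_re, hα2, LinearMap.zero_apply,
      Complex.zero_re, Complex.re_ofNat] at h4
    linarith
  obtain ⟨β, hβt, ψ, hψ, hpos⟩ := hneg
  classical
  have hβP : β ∈ P := hl β (by simp [hβt])
  have hsum0 : α + β ≠ 0 := fun h ↦ by
    have hx := hP.xor_neg α (hP.isRoot α hαP)
    rw [← eq_neg_of_add_eq_zero_right h] at hx
    simp [Xor, hαP, hβP] at hx
  have hroot : IsRoot c (α + β) := by
    refine isRoot_iff.2 ⟨hsum0, ?_⟩
    have := (rootSpace_zsmul_add_ne_bot_iff χ ψ hχ 1).2 ⟨by exact_mod_cast hpos, by lia⟩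
    rwa [one_smul, hχα, hψ] at this
  have hperm := List.perm_cons_erase hβt
  -- Merging `α` and `β` into the positive root `α + β` keeps the sum and shortens the list, yet
  -- leaves it nonempty.
  have := ih ((α + β) :: t.erase β) (by
      intro γ hγ
      obtain rfl | hγ := List.mem_cons.1 hγ
      · exact hP.add_mem _ hαP _ hβP hroot
      · exact hl γ (by simp [List.mem_of_mem_erase hγ]))
    (by rw [← hsum, List.sum_cons, List.sum_cons, hperm.sum_eq, List.sum_cons, add_assoc])
    (by
      have := hperm.length_eq
      simp only [List.length_cons] at hn this ⊢
      lia)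
  simp at this

theorem IsPositiveSystem.eq_zero_of_add_eq_zero {P : Set (Module.Dual ℂ (cplx c))}
    (hP : IsPositiveSystem c P) {s t : Module.Dual ℂ (cplx c)} (hs : s ∈ AddSubmonoid.closure P)
    (ht : t ∈ AddSubmonoid.closure P) (hst : s + t = 0) : s = 0 := by
  obtain ⟨l, hl, rfl⟩ := AddSubmonoid.exists_list_of_mem_closure hs
  obtain ⟨m, hm, rfl⟩ := AddSubmonoid.exists_list_of_mem_closure ht
  have := hP.eq_nil_of_sum_eq_zero (l ++ m)
    (fun α hα ↦ (List.mem_append.1 hα).elim (hl α) (hm α)) (by rw [List.sum_append, hst])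
  simp [(List.append_eq_nil_iff.1 this).1]

/-- `g^ℂ = c^ℂ + 𝔶⁺ + 𝔶⁻`. -/
theorem IsPositiveSystem.span_eq_top {P : Set (Module.Dual ℂ (cplx c))}
    (hP : IsPositiveSystem c P) :
    Submodule.span ℂ ((cplx c : Set (ℂ ⊗[ℝ] g)) ∪ {x | ∃ α ∈ P, IsRootVector c α x} ∪
      {x | ∃ α ∈ P, IsRootVector c (-α) x}) = ⊤ := by
  rw [eq_top_iff, ← LieSubmodule.top_toSubmodule (R := ℂ) (L := cplx c),
    ← cartan_sup_iSup_rootSpace_eq_top (cplx c)]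
  simp only [LieSubmodule.sup_toSubmodule, LieSubmodule.iSup_toSubmodule, sup_le_iff, iSup_le_iff]
  refine ⟨fun x hx ↦ Submodule.subset_span (.inl (.inl hx)), fun χ hχ x hx ↦ ?_⟩
  have hx' : IsRootVector c χ.toLinear x := fun h ↦ lie_eq_smul_of_mem_rootSpace hx h
  apply Submodule.subset_span
  obtain h | h := (hP.xor_neg _ hχ.isRoot).or
  · exact .inl (.inr ⟨_, h, hx'⟩)
  · exact .inr ⟨_, h, by rwa [neg_neg]⟩

end PositiveSystem

/-! ### Uniqueness of the high weight. -/

section HighWeight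

open LieAlgebra LieAlgebra.IsKilling LieModule

/-- If `L` is spanned by `B` together with elements sending `v` to multiples of itself, then the
smallest `B`-stable subspace containing `v` is `L`-stable. -/
theorem exists_lieSubmodule_forall_le {K L M : Type*} [Field K] [LieRing L] [LieAlgebra K L]
    [AddCommGroup M] [Module K M] [LieRingModule L M] [LieModule K L M] {B C : Set L}
    (hBC : Submodule.span K (C ∪ B) = ⊤) {v : M} (hv : ∀ x ∈ C, ∃ a : K, ⁅x, v⁆ = a • v) :
    ∃ N : LieSubmodule K L M, v ∈ N ∧ ∀ S : Submodule K M, v ∈ S →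
      (∀ b ∈ B, ∀ w ∈ S, ⁅b, w⁆ ∈ S) → N.toSubmodule ≤ S := by
  let W : Submodule K M := sInf {S | v ∈ S ∧ ∀ b ∈ B, ∀ w ∈ S, ⁅b, w⁆ ∈ S}
  have hvW : v ∈ W := Submodule.mem_sInf.2 fun S hS ↦ hS.1
  have hBW : ∀ b ∈ B, ∀ w ∈ W, ⁅b, w⁆ ∈ W := fun b hb w hw ↦
    Submodule.mem_sInf.2 fun S hS ↦ hS.2 b hb w (Submodule.mem_sInf.1 hw S hS)
  let T : Submodule K M :=
    { carrier := {w | w ∈ W ∧ ∀ x : L, ⁅x, w⁆ ∈ W}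
      zero_mem' := by simp
      add_mem' := fun ha hb ↦ ⟨add_mem ha.1 hb.1, fun x ↦ by
        rw [lie_add]; exact add_mem (ha.2 x) (hb.2 x)⟩
      smul_mem' := fun a w hw ↦ ⟨W.smul_mem a hw.1, fun x ↦ by
        rw [lie_smul]; exact W.smul_mem a (hw.2 x)⟩ }
  -- `W ≤ T` says that `W` is `L`-stable; by minimality of `W` it suffices that `T` contains `v` and
  -- is `B`-stable.
  have hWT : W ≤ T := by
    refine sInf_le ⟨⟨hvW, fun x ↦ ?_⟩, fun b hb w hw ↦ ⟨hBW b hb w hw.1, fun x ↦ ?_⟩⟩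
    · have hx : x ∈ Submodule.span K (C ∪ B) := hBC ▸ Submodule.mem_top
      induction hx using Submodule.span_induction with
      | zero => simp
      | add a b _ _ ha hb => rw [add_lie]; exact add_mem ha hb
      | smul a x _ hx => rw [smul_lie]; exact W.smul_mem a hx
      | mem x hx =>
        obtain hx | hx := hx
        · obtain ⟨a, ha⟩ := hv x hx
          exact ha ▸ W.smul_mem a hvW
        · exact hBW x hx v hvW
    -- The term `⁅⁅x, b⁆, w⁆` is in `W` because membership in `T` quantifies over all of `L`,
    -- including `⁅x, b⁆`.
    · rw [leibniz_lie]
      exact add_mem (hw.2 _) (hBW b hb _ (hw.2 x))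
  exact ⟨{ W with lie_mem := fun {x w} hw ↦ (hWT hw).2 x }, hvW, fun S h1 h2 ↦ sInf_le ⟨h1, h2⟩⟩

theorem _root_.LieSubmodule.eq_bot_or_eq_of_le_of_isIrreducible {K L M : Type*} [Field K]
    [LieRing L] [LieAlgebra K L] [AddCommGroup M] [Module K M] [LieRingModule L M]
    [LieModule K L M] {N N' : LieSubmodule K L M} [IsIrreducible K L N] (h : N' ≤ N) :
    N' = ⊥ ∨ N' = N := by
  obtain h' | h' := IsSimpleOrder.eq_bot_or_eq_top (N'.comap N.incl)
  · left
    rwa [LieSubmodule.comap_incl_eq_bot, inf_eq_right.2 h] at h'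
  · right
    exact le_antisymm h (LieSubmodule.comap_incl_eq_top.1 h')

variable {g V : Type*} [LieRing g] [LieAlgebra ℝ g] [FiniteDimensional ℝ g]
  [AddCommGroup V] [Module ℝ V] [LieRingModule g V] [LieModule ℝ g V]
  {c : LieSubalgebra ℝ g} [IsKilling ℂ (ℂ ⊗[ℝ] g)] [(cplx c).IsCartanSubalgebra]
  {P : Set (Module.Dual ℂ (cplx c))}
  {M : LieSubmodule ℂ (ℂ ⊗[ℝ] g) (ℂ ⊗[ℝ] V)} {lam mu : Module.Dual ℂ (cplx c)}

/-- The weights of an irreducible module of high weight `lam` are of the form `lam - s` with `s` a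
sum of positive roots. -/
theorem IsHighWeight.exists_add_eq (hP : IsPositiveSystem c P)
    [IsIrreducible ℂ (ℂ ⊗[ℝ] g) M] (hlam : IsHighWeight c (nilRadical c P) M lam)
    {w : ℂ ⊗[ℝ] V} (hwM : w ∈ M) (hw0 : w ≠ 0)
    (hw : ∀ h : cplx c, ⁅(h : ℂ ⊗[ℝ] g), w⁆ = mu h • w) :
    ∃ s ∈ AddSubmonoid.closure P, mu + s = lam := by
  obtain ⟨v, hvM, hv0, hvn, hvh⟩ := hlam
  obtain ⟨N, hvN, hN⟩ := exists_lieSubmodule_forall_le hP.span_eq_top (v := v) (by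
    rintro x (hx | ⟨α, hα, hx⟩)
    · exact ⟨_, hvh ⟨x, hx⟩⟩
    · exact ⟨0, by rw [zero_smul]; exact hvn x (Submodule.subset_span ⟨α, hα, hx⟩)⟩)
  have hMN : M ≤ N := by
    obtain h | h := LieSubmodule.eq_bot_or_eq_of_le_of_isIrreducible (inf_le_left : M ⊓ N ≤ M)
    · have hv : v ∈ M ⊓ N := ⟨hvM, hvN⟩
      rw [h] at hv
      exact absurd ((LieSubmodule.mem_bot _).1 hv) hv0
    · exact inf_eq_left.1 h
  let A : Submodule ℂ (ℂ ⊗[ℝ] V) := Submodule.span ℂ {u | ∃ s ∈ AddSubmonoid.closure P,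
    ∀ h : cplx c, ⁅(h : ℂ ⊗[ℝ] g), u⁆ = (lam - s) h • u}
  have hNA : N.toSubmodule ≤ A := by
    refine hN A (Submodule.subset_span ⟨0, zero_mem _, by simpa using hvh⟩) ?_
    rintro b ⟨α, hα, hb⟩ u hu
    induction hu using Submodule.span_induction with
    | zero => simp
    | add a b _ _ ha hb => rw [lie_add]; exact add_mem ha hb
    | smul a x _ hx => rw [lie_smul]; exact A.smul_mem a hx
    | mem u hu =>
      obtain ⟨s, hs, hu⟩ := hu
      refine Submodule.subset_span ⟨s + α, add_mem hs (AddSubmonoid.subset_closure hα), fun h ↦ ?_⟩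
      rw [leibniz_lie, hb h, hu h, smul_lie ((-α) h) b u, lie_smul ((lam - s) h) b u, ← add_smul]
      congr 1
      simp only [LinearMap.neg_apply, LinearMap.sub_apply, LinearMap.add_apply]
      ring
  by_contra! hne
  -- If `mu` is not of the required form, `A` involves only weights other than `mu`, and
  -- independence of generalized weight spaces excludes `w`.
  have hAle : A ≤ (⨆ χ ≠ (mu : cplx c → ℂ), genWeightSpace (ℂ ⊗[ℝ] V) χ).toSubmodule := by
    refine Submodule.span_le.2 fun u ⟨s, hs, hu⟩ ↦ ?_
    have hχ : ((lam - s : Module.Dual ℂ (cplx c)) : cplx c → ℂ) ≠ mu := fun h ↦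
      hne s hs (by rw [← DFunLike.coe_injective h, sub_add_cancel])
    exact (le_iSup₂ (f := fun (χ : cplx c → ℂ) (_ : χ ≠ mu) ↦ genWeightSpace (ℂ ⊗[ℝ] V) χ) _ hχ)
      (weightSpace_le_genWeightSpace _ _ ((mem_weightSpace ..).2 hu))
  have hwmu : w ∈ genWeightSpace (ℂ ⊗[ℝ] V) (mu : cplx c → ℂ) :=
    weightSpace_le_genWeightSpace _ _ ((mem_weightSpace ..).2 hw)
  have hdis := iSupIndep_genWeightSpace ℂ (cplx c) (ℂ ⊗[ℝ] V) (mu : cplx c → ℂ)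
  have : w ∈ (⊥ : LieSubmodule ℂ (cplx c) (ℂ ⊗[ℝ] V)) :=
    hdis.le_bot ⟨hwmu, hAle (hNA (hMN hwM))⟩
  exact hw0 (by simpa using this)

/-- An irreducible module has at most one high weight. -/
theorem IsHighWeight.unique (hP : IsPositiveSystem c P) [IsIrreducible ℂ (ℂ ⊗[ℝ] g) M]
    (hlam : IsHighWeight c (nilRadical c P) M lam) (hmu : IsHighWeight c (nilRadical c P) M mu) :
    lam = mu := by
  obtain ⟨v, hvM, hv0, -, hv⟩ := id hlam
  obtain ⟨w, hwM, hw0, -, hw⟩ := id hmu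
  obtain ⟨s, hs, hs'⟩ := hlam.exists_add_eq hP hwM hw0 hw
  obtain ⟨t, ht, ht'⟩ := hmu.exists_add_eq hP hvM hv0 hv
  have hst : s + t = 0 := by
    have : mu + (s + t) = mu := by rw [← add_assoc, hs', ht']
    simpa using this
  rw [← hs', hP.eq_zero_of_add_eq_zero hs ht hst, add_zero]

end HighWeight

/-! ### Conjugation-stable submodules and real points. -/

section Conjugate

open LieModule

variable {g V : Type*} [LieRing g] [LieAlgebra ℝ g]
  [AddCommGroup V] [Module ℝ V] [LieRingModule g V] [LieModule ℝ g V]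
  {M N N' : LieSubmodule ℂ (ℂ ⊗[ℝ] g) (ℂ ⊗[ℝ] V)}

theorem conj_mem_conjSubmodule {x : ℂ ⊗[ℝ] V} (hx : x ∈ M) : conj V x ∈ conjSubmodule M :=
  ⟨x, hx, rfl⟩

/-- If `W` meets `N` and `N'` trivially and `N ⊆ W + N'`, then every high weight of `N` is a high
weight of `N'`. -/
theorem IsHighWeight.of_le_sup {c : LieSubalgebra ℝ g} {P : Set (Module.Dual ℂ (cplx c))}
    {lam : Module.Dual ℂ (cplx c)} (hlam : IsHighWeight c (nilRadical c P) N lam)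
    {W : LieSubmodule ℂ (ℂ ⊗[ℝ] g) (ℂ ⊗[ℝ] V)} (hW : W ⊓ N = ⊥) (hW' : W ⊓ N' = ⊥)
    (hle : N ≤ W ⊔ N') : IsHighWeight c (nilRadical c P) N' lam := by
  obtain ⟨v, hvN, hv0, hvn, hvh⟩ := hlam
  obtain ⟨w, hw, u, hu, rfl⟩ := (LieSubmodule.mem_sup _ _ _).1 (hle hvN)
  -- As `W` and `N'` are independent, the equations satisfied by `v = w + u` hold for its component
  -- `u`.
  have key : ∀ x ∈ W, ∀ y ∈ N', x + y = 0 → y = 0 := by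
    intro x hx y hy h
    have : y ∈ W ⊓ N' := ⟨by rw [eq_neg_of_add_eq_zero_right h]; exact neg_mem hx, hy⟩
    simpa [hW'] using this
  refine ⟨u, hu, ?_, fun n hn ↦ key ⁅n, w⁆ (W.lie_mem hw) _ (N'.lie_mem hu) ?_, fun h ↦ ?_⟩
  · rintro rfl
    have : w ∈ W ⊓ N := ⟨hw, by simpa using hvN⟩
    exact hv0 (by simpa [hW] using this)
  · rw [← lie_add n w u, hvn n hn]
  · refine sub_eq_zero.1 (key (⁅(h : ℂ ⊗[ℝ] g), w⁆ - lam h • w)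
      (sub_mem (W.lie_mem hw) (W.smul_mem _ hw)) _
      (sub_mem (N'.lie_mem hu) (N'.smul_mem _ hu)) ?_)
    have := hvh h
    rw [lie_add (h : ℂ ⊗[ℝ] g) w u, smul_add] at this
    rw [sub_add_sub_comm, this, sub_self]

/-- A conjugation-stable subspace of `M + M̄` which does not contain `M` meets `M` and `M̄` trivially,
and `M` is contained in its sum with `M̄`. -/
theorem le_sup_conjSubmodule_of_not_le [IsIrreducible ℂ (ℂ ⊗[ℝ] g) M]
    [IsIrreducible ℂ (ℂ ⊗[ℝ] g) (conjSubmodule M)]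
    {W : LieSubmodule ℂ (ℂ ⊗[ℝ] g) (ℂ ⊗[ℝ] V)} (hW : W ≤ M ⊔ conjSubmodule M) (hW0 : W ≠ ⊥)
    (hconj : ∀ x ∈ W, conj V x ∈ W) (hM : ¬ M ≤ W) :
    W ⊓ M = ⊥ ∧ W ⊓ conjSubmodule M = ⊥ ∧ M ≤ W ⊔ conjSubmodule M := by
  have h1 : W ⊓ M = ⊥ :=
    (LieSubmodule.eq_bot_or_eq_of_le_of_isIrreducible inf_le_right).resolve_right
      fun h ↦ hM (inf_eq_right.1 h)
  have h2 : W ⊓ conjSubmodule M = ⊥ := by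
    refine (LieSubmodule.eq_bot_or_eq_of_le_of_isIrreducible inf_le_right).resolve_right
      fun h ↦ hM fun x hx ↦ ?_
    rw [← conj_conj x]
    exact hconj _ (inf_eq_right.1 h (conj_mem_conjSubmodule hx))
  refine ⟨h1, h2, ?_⟩
  -- If this intersection vanished, every element of `W` would have zero `M`-component, putting `W`
  -- inside `M̄`, which it meets trivially.
  obtain h | h := LieSubmodule.eq_bot_or_eq_of_le_of_isIrreducible
    (inf_le_right : (W ⊔ conjSubmodule M) ⊓ M ≤ M)
  · refine absurd ((LieSubmodule.eq_bot_iff W).2 fun w hw ↦ ?_) hW0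
    obtain ⟨m, hm, m', hm', rfl⟩ := (LieSubmodule.mem_sup _ _ _).1 (hW hw)
    have hm0 : m ∈ (W ⊔ conjSubmodule M) ⊓ M := by
      refine ⟨?_, hm⟩
      rw [← add_sub_cancel_right m m']
      exact sub_mem ((le_sup_left : W ≤ _) hw) ((le_sup_right : conjSubmodule M ≤ _) hm')
    rw [h, LieSubmodule.mem_bot] at hm0
    subst hm0
    have hw' : 0 + m' ∈ W ⊓ conjSubmodule M := ⟨hw, by rwa [zero_add]⟩
    rwa [h2, LieSubmodule.mem_bot] at hw'
  · exact inf_eq_right.1 h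

/-- For nonzero `m` in `M`, the vector `m + conj V m` is real; were it zero, `m` would lie in `M ∩
M̄`. -/
theorem nontrivial_realPoints_sup_conjSubmodule (hdis : Disjoint M (conjSubmodule M))
    (hM : M ≠ ⊥) : Nontrivial (realPoints (M ⊔ conjSubmodule M)) := by
  obtain ⟨m, hm, hm0⟩ := LieSubmodule.exists_mem_ne_zero hM
  have hsum : m + conj V m ∈ M ⊔ conjSubmodule M :=
    add_mem ((le_sup_left : M ≤ _) hm)
      ((le_sup_right : conjSubmodule M ≤ _) (conj_mem_conjSubmodule hm))
  rw [add_conj] at hsum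
  refine ⟨⟨⟨(2 : ℝ) • rePart V m, hsum⟩, 0, fun h ↦ hm0 ?_⟩⟩
  have h0 : m + conj V m = 0 := by
    rw [add_conj, show (2 : ℝ) • rePart V m = 0 from congrArg Subtype.val h,
      TensorProduct.tmul_zero]
  have : m ∈ M ⊓ conjSubmodule M :=
    ⟨hm, by rw [eq_neg_of_add_eq_zero_left h0]; exact neg_mem (conj_mem_conjSubmodule hm)⟩
  rwa [hdis.eq_bot, LieSubmodule.mem_bot] at this

/-- The complexification of an invariant `U` is `conj`-stable, so once it contains `M` it contains
`M̄`; taking real parts then recovers every real point in `U`. -/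
theorem isIrreducible_realPoints_sup_conjSubmodule (hdis : Disjoint M (conjSubmodule M))
    (hM : M ≠ ⊥) (H : ∀ W : LieSubmodule ℂ (ℂ ⊗[ℝ] g) (ℂ ⊗[ℝ] V), W ≤ M ⊔ conjSubmodule M →
      W ≠ ⊥ → (∀ x ∈ W, conj V x ∈ W) → M ≤ W) :
    IsIrreducible ℝ g (realPoints (M ⊔ conjSubmodule M)) := by
  have := nontrivial_realPoints_sup_conjSubmodule hdis hM
  refine .mk fun U hU ↦ ?_
  set U' : LieSubmodule ℝ g V := U.map (realPoints (M ⊔ conjSubmodule M)).incl with hU'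
  have hmem : ∀ x : ℂ ⊗[ℝ] V, x ∈ U'.baseChange ℂ ↔ rePart V x ∈ U' ∧ imPart V x ∈ U' :=
    fun x ↦ mem_baseChange_iff_rePart_imPart (p := U'.toSubmodule)
  have hreal : ∀ v ∈ U', (1 : ℂ) ⊗ₜ[ℝ] v ∈ M ⊔ conjSubmodule M := by
    intro v hv
    obtain ⟨u, -, rfl⟩ := (LieSubmodule.mem_map _).1 hv
    exact u.2
  have hconj : ∀ x ∈ U'.baseChange ℂ, conj V x ∈ U'.baseChange ℂ := by
    intro x hx
    have hx' := (hmem x).1 hx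
    rw [← rePart_add_imPart x, map_add, conj_smul, conj_tmul, conj_tmul, map_one]
    exact add_mem (LieSubmodule.tmul_mem_baseChange_of_mem _ hx'.1)
      ((LieSubmodule.baseChange ℂ U').smul_mem _ (LieSubmodule.tmul_mem_baseChange_of_mem _ hx'.2))
  have hMW : M ≤ U'.baseChange ℂ := by
    refine H _ (fun x hx ↦ ?_) (fun h0 ↦ ?_) hconj
    · have hx' := (hmem x).1 hx
      rw [← rePart_add_imPart x]
      exact add_mem (hreal _ hx'.1)
        (Submodule.smul_mem (M ⊔ conjSubmodule M).toSubmodule _ (hreal _ hx'.2))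
    · obtain ⟨u, hu, hu0⟩ := LieSubmodule.exists_mem_ne_zero hU
      have h := LieSubmodule.tmul_mem_baseChange_of_mem (R := ℝ) (1 : ℂ)
        (LieSubmodule.mem_map_of_mem (f := (realPoints (M ⊔ conjSubmodule M)).incl) hu)
      rw [← hU', h0, LieSubmodule.mem_bot, one_tmul_eq_zero_iff] at h
      exact hu0 (Subtype.ext h)
  have hle : M ⊔ conjSubmodule M ≤ U'.baseChange ℂ := by
    refine sup_le hMW ?_
    rintro _ ⟨m, hm, rfl⟩
    exact hconj _ (hMW hm)
  rw [eq_top_iff]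
  rintro ⟨v, hv⟩ -
  have hv' := ((hmem _).1 (hle hv)).1
  rw [rePart_tmul, Complex.one_re, one_smul] at hv'
  obtain ⟨u, hu, rfl⟩ := (LieSubmodule.mem_map _).1 hv'
  exact hu

end Conjugate

end RealRep

end

theorem lemma4p6 {g V : Type*}
    [LieRing g] [LieAlgebra ℝ g] [FiniteDimensional ℝ g] [LieAlgebra.IsSemisimple ℝ g]
    [AddCommGroup V] [Module ℝ V] [FiniteDimensional ℝ V] [LieRingModule g V] [LieModule ℝ g V]
    (c : LieSubalgebra ℝ g) (hc : c.IsCartanSubalgebra)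
    (P : Set (Module.Dual ℂ (RealRep.cplx c))) (hP : RealRep.IsPositiveSystem c P)
    (M : LieSubmodule ℂ (TensorProduct ℝ ℂ g) (TensorProduct ℝ ℂ V))
    (hM : LieModule.IsIrreducible ℂ (TensorProduct ℝ ℂ g) M)
    (hM' : LieModule.IsIrreducible ℂ (TensorProduct ℝ ℂ g) (RealRep.conjSubmodule M))
    (lam mu : Module.Dual ℂ (RealRep.cplx c))
    (hlam : RealRep.IsHighWeight c (RealRep.nilRadical c P) M lam)
    (hmu : RealRep.IsHighWeight c (RealRep.nilRadical c P) (RealRep.conjSubmodule M) mu)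
    (hne : lam ≠ mu) :
    Disjoint M (RealRep.conjSubmodule M) ∧
      LieModule.IsIrreducible ℝ g (RealRep.realPoints (M ⊔ RealRep.conjSubmodule M)) := by
  -- Cartan's criterion: in characteristic zero, semisimplicity makes the Killing form
  -- nondegenerate.
  have := LieAlgebra.HasTrivialRadical.instIsKilling ℝ g
  have := RealRep.isKilling_complexification (g := g)
  have := RealRep.isCartanSubalgebra_cplx c
  have hM0 : M ≠ ⊥ := by
    obtain ⟨v, hv, hv0, -⟩ := hlam
    rintro rfl
    exact hv0 ((LieSubmodule.mem_bot _).1 hv)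
  have hdis : Disjoint M (RealRep.conjSubmodule M) := by
    rw [disjoint_iff]
    by_contra hne0
    have h1 := (LieSubmodule.eq_bot_or_eq_of_le_of_isIrreducible
      (inf_le_left : M ⊓ RealRep.conjSubmodule M ≤ M)).resolve_left hne0
    have h2 := (LieSubmodule.eq_bot_or_eq_of_le_of_isIrreducible
      (inf_le_right : M ⊓ RealRep.conjSubmodule M ≤ _)).resolve_left hne0
    rw [← h2, h1] at hmu
    exact hne (hlam.unique hP hmu)
  refine ⟨hdis, RealRep.isIrreducible_realPoints_sup_conjSubmodule hdis hM0
    fun W hW hW0 hconj ↦ ?_⟩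
  by_contra hMW
  obtain ⟨h1, h2, h3⟩ := RealRep.le_sup_conjSubmodule_of_not_le hW hW0 hconj hMW
  exact hne ((hlam.of_le_sup h1 h2 h3).unique hP hmu)
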